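/- Let $\mathcal D(x,y)=\max\{|x|+\tfrac1{\sqrt3}|y|,\ \tfrac2{\sqrt3}|y|\}$ on $\mathbb R^2$, and for a curve $\lambda:[0,1]\to\mathbb R^2$ let $\rho(\lambda)=\sup\sum_{i}\mathcal D(\lambda(t_{i+1})-\lambda(t_i))$, the supremum being over all finite sequences $0\le t_0\le t_1\le\dots\le t_n\le 1$. If the topological boundary $\partial A$ of a set $A\subset\mathbb R^2$ is the image of a closed, simple, rectifiable curve $\lambda$, we say that $A$ has the perimeter $\rho(\partial A)=\rho(\lambda)$. Let $\mu$ be Lebesgue measure on $\mathbb R^2$, let $H$ be the regular hexagon that is the convex hull of $(\pm1,0)$ and $(\pm\tfrac12,\pm\tfrac{\sqrt3}2)$ (all choices of signs), and let $H_1=\mu(H)^{-1/2}H$, its rescaled copy of area $1$. Then: (a) $H$ is the closed unit ball of $\mathcal D$. (b) Among the simply connected open sets $A\subset\mathbb R^2$ with $\mu(A)=1$ whose boundary is a closed, simple, rectifiable curve, those of least perimeter $\rho(\partial A)$ are exactly the interiors of the translates $v+H_1$, $v\in\mathbb R^2$. (c) Among all sets $A\subset\mathbb R^2$ with $\mu(A)=1$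 whose boundary is a closed, simple, rectifiable curve, those of least perimeter are exactly the sets $A$ with $\operatorname{int}(v+H_1)\subseteq A\subseteq v+H_1$ for some $v\in\mathbb R^2$. In particular, minimizers exist, and up to translation and boundary points the minimizer is unique: it is the regular hexagon $H_1$. -/

import Mathlib

open MeasureTheory Set
open scoped ENNReal Pointwise

noncomputable section

namespace HexIso

/-- The hexagonal norm `𝒟(x, y) = max {|x| + |y|/√3, 2|y|/√3}` on the plane. The plane is `ℝ × ℝ`
with its usual topology and its Lebesgue measure `volume`; the sup norm of `ℝ × ℝ` is not used. -/
def hexNorm (p : ℝ × ℝ) : ℝ :=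
  max (|p.1| + 1 / √3 * |p.2|) (2 / √3 * |p.2|)

/-- The length `ρ(γ)` with respect to `𝒟` of a curve `γ : [0, 1] → ℝ²`: the supremum of
`∑ 𝒟(γ(tᵢ₊₁) - γ(tᵢ))` over all finite sequences `t₀ ≤ t₁ ≤ ⋯ ≤ tₙ` in `[0, 1]`. -/
def hexLength (γ : ℝ → ℝ × ℝ) : ℝ≥0∞ :=
  ⨆ (n : ℕ) (t : ℕ → ℝ) (_ : Monotone t) (_ : ∀ i, t i ∈ Icc (0 : ℝ) 1),
    ∑ i ∈ Finset.range n, ENNReal.ofReal (hexNorm (γ (t (i + 1)) - γ (t i)))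

/-- `γ`, restricted to `[0, 1]`, is a closed, simple, rectifiable curve which parametrizes the
topological boundary of `A`. -/
structure IsBoundaryCurve (A : Set (ℝ × ℝ)) (γ : ℝ → ℝ × ℝ) : Prop where
  continuousOn : ContinuousOn γ (Icc 0 1)
  closed : γ 0 = γ 1
  simple : InjOn γ (Ico 0 1)
  rectifiable : hexLength γ ≠ ⊤
  image_eq : γ '' Icc 0 1 = frontier A

/-- `A` has perimeter `ρ(∂A) = ℓ`: its boundary is a closed, simple, rectifiable curve of
length `ℓ` with respect to `𝒟`. -/
def HasHexPerimeter (A : Set (ℝ × ℝ)) (ℓ : ℝ≥0∞) : Prop :=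
  ∃ γ : ℝ → ℝ × ℝ, IsBoundaryCurve A γ ∧ hexLength γ = ℓ

/-- `A` solves the isoperimetric problem in the class `C` of plane sets: it belongs to `C`, has
area 1 and a perimeter, and no member of `C` with area 1 has a smaller perimeter. -/
def IsIsoperimetricSolution (C : Set (Set (ℝ × ℝ))) (A : Set (ℝ × ℝ)) : Prop :=
  A ∈ C ∧ volume A = 1 ∧ ∃ ℓ, HasHexPerimeter A ℓ ∧
    ∀ A' ∈ C, volume A' = 1 → ∀ ℓ', HasHexPerimeter A' ℓ' → ℓ ≤ ℓ'

/-- The class of simply connected open plane sets. -/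
def simplyConnectedOpenSets : Set (Set (ℝ × ℝ)) :=
  {A | IsOpen A ∧ IsSimplyConnected A}

/-- The closed regular hexagon `H` with center `0` and vertices at the sixth roots of unity. -/
def regularHexagon : Set (ℝ × ℝ) :=
  convexHull ℝ {(1, 0), (1 / 2, √3 / 2), (-1 / 2, √3 / 2),
    (-1, 0), (-1 / 2, -√3 / 2), (1 / 2, -√3 / 2)}

/-- The hexagon `H / √(area of H)`, the rescaled copy of `H` with area 1. -/
def unitAreaHexagon : Set (ℝ × ℝ) :=
  (√(volume regularHexagon).toReal)⁻¹ • regularHexagon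

/-- The translate of the area 1 hexagon with center `v`. -/
def unitAreaHexagonAt (v : ℝ × ℝ) : Set (ℝ × ℝ) :=
  (fun p => v + p) '' unitAreaHexagon

end HexIso

end

namespace HexIso

/-! In the skew coordinates `s = skewX`, `t = skewY` the norm is `max(|s|, |t|, |s + t|)`, which is
also half the sum of the three absolute values (`hexNorm_eq_half_sum`). A closed curve varies in
each of these coordinates by at least twice its width there, so its length is at least the sum `w₁ +
w₂ + w₃` of the three widths (`ofReal_widths_le_hexLength`). The set lies in the circumscribed
hexagon with these widths, whose area is `√3 / 2 * E` with `E` an explicit quadratic form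
(`volume_skewHexagon`). Since `(w₁ + w₂ + w₃)² - 12 * E` is a sum of squares, area at least 1 forces
length at least `6 * unitSide` (`le_hexLength`).

In the equality case all squares vanish and the circumscribed hexagon is a ball of area 1, so
`closure A` fills it (`exists_closure_eq_hexBall`). This still allows slits, that is, frontier
points inside the hexagon. But the boundary curve passes through the six vertices, which are at
mutual distance at least the side `r`; length `6 * r` leaves at most `r` for the passage between two
vertices through any further point, and such a point cannot be interior
(`le_hexNorm_of_vertices_mem`). Hence the open hexagon misses the frontier and, being connected,
lies in `A`. Conversely, `hexCurve` attains the bound. -/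

/-! ### Skew coordinates and the hexagonal norm -/

/-- The first coordinate in the basis of two adjacent vertices of the regular hexagon. -/
noncomputable def skewX (p : ℝ × ℝ) : ℝ := p.1 - 1 / √3 * p.2

/-- The second coordinate in the basis of two adjacent vertices of the regular hexagon. -/
noncomputable def skewY (p : ℝ × ℝ) : ℝ := 2 / √3 * p.2

/-- The point with given skew coordinates. -/
noncomputable def ofSkew (s t : ℝ) : ℝ × ℝ := (s + t / 2, √3 / 2 * t)

theorem sqrt_three_pos : 0 < √(3 : ℝ) := by positivity

@[simp] theorem skewX_ofSkew (s t : ℝ) : skewX (ofSkew s t) = s := by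
  have := sqrt_three_pos
  simp only [skewX, ofSkew]; field_simp; ring

@[simp] theorem skewY_ofSkew (s t : ℝ) : skewY (ofSkew s t) = t := by
  have := sqrt_three_pos
  simp only [skewY, ofSkew]; field_simp

@[simp] theorem ofSkew_skew (p : ℝ × ℝ) : ofSkew (skewX p) (skewY p) = p := by
  have := sqrt_three_pos
  ext
  · simp only [skewX, skewY, ofSkew]; field_simp; ring
  · simp only [skewY, ofSkew]; field_simp

theorem ext_skew {p q : ℝ × ℝ} (hx : skewX p = skewX q) (hy : skewY p = skewY q) : p = q := by
  rw [← ofSkew_skew p, ← ofSkew_skew q, hx, hy]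

@[simp] theorem skewX_add (p q : ℝ × ℝ) : skewX (p + q) = skewX p + skewX q := by
  simp only [skewX, Prod.fst_add, Prod.snd_add]; ring

@[simp] theorem skewY_add (p q : ℝ × ℝ) : skewY (p + q) = skewY p + skewY q := by
  simp only [skewY, Prod.snd_add]; ring

@[simp] theorem skewX_sub (p q : ℝ × ℝ) : skewX (p - q) = skewX p - skewX q := by
  simp only [skewX, Prod.fst_sub, Prod.snd_sub]; ring

@[simp] theorem skewY_sub (p q : ℝ × ℝ) : skewY (p - q) = skewY p - skewY q := by
  simp only [skewY, Prod.snd_sub]; ring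

@[simp] theorem skewX_smul (c : ℝ) (p : ℝ × ℝ) : skewX (c • p) = c * skewX p := by
  simp only [skewX, Prod.smul_fst, Prod.smul_snd, smul_eq_mul]; ring

@[simp] theorem skewY_smul (c : ℝ) (p : ℝ × ℝ) : skewY (c • p) = c * skewY p := by
  simp only [skewY, Prod.smul_snd, smul_eq_mul]; ring

@[fun_prop] theorem continuous_skewX : Continuous skewX := by unfold skewX; fun_prop

@[fun_prop] theorem continuous_skewY : Continuous skewY := by unfold skewY; fun_prop

/-- With `y' = y / √3` the three skew coordinates are `x - y'`, `2 * y'` and `x + y'`, and `|x| +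
|y'| = max(|x - y'|, |x + y'|)`. -/
theorem hexNorm_eq (p : ℝ × ℝ) :
    hexNorm p = max |skewX p| (max |skewY p| |skewX p + skewY p|) := by
  have h3 := sqrt_three_pos
  have e : 1 / √3 * |p.2| = |1 / √3 * p.2| := by
    rw [abs_mul, abs_of_pos (a := 1 / √3) (by positivity)]
  have e2 : 2 / √3 * |p.2| = |2 / √3 * p.2| := by
    rw [abs_mul, abs_of_pos (a := 2 / √3) (by positivity)]
  have e3 : 2 / √3 * p.2 = 2 * (1 / √3 * p.2) := by ring
  rw [hexNorm, skewX, skewY, e, e2, e3]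
  generalize 1 / √3 * p.2 = y
  rw [show p.1 - y + 2 * y = p.1 + y by ring]
  apply le_antisymm
  · apply max_le
    · rcases abs_cases p.1 with h | h <;> rcases abs_cases y with h' | h' <;>
        rw [h.1, h'.1] <;>
        simp only [le_max_iff, le_abs] <;> grind
    · simp
  · refine max_le ?_ (max_le (le_max_right _ _) ?_) <;> refine le_trans ?_ (le_max_left _ _)
    · exact abs_sub _ _
    · exact abs_add_le _ _

/-- The numbers `s`, `t`, `-(s + t)` sum to zero, so the largest absolute value is the sum of the
other two. This form splits length into three one-dimensional variations. -/
theorem hexNorm_eq_half_sum (p : ℝ × ℝ) :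
    hexNorm p = (|skewX p| + |skewY p| + |skewX p + skewY p|) / 2 := by
  rw [hexNorm_eq]
  generalize skewX p = s
  generalize skewY p = t
  rcases abs_cases s with h | h <;> rcases abs_cases t with h' | h' <;>
    rcases abs_cases (s + t) with h'' | h'' <;> rw [h.1, h'.1, h''.1] <;>
    simp only [max_def] <;> grind

theorem hexNorm_le_iff {p : ℝ × ℝ} {r : ℝ} :
    hexNorm p ≤ r ↔ |skewX p| ≤ r ∧ |skewY p| ≤ r ∧ |skewX p + skewY p| ≤ r := by
  rw [hexNorm_eq]; simp

theorem hexNorm_lt_iff {p : ℝ × ℝ} {r : ℝ} :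
    hexNorm p < r ↔ |skewX p| < r ∧ |skewY p| < r ∧ |skewX p + skewY p| < r := by
  rw [hexNorm_eq]; simp

theorem hexNorm_nonneg (p : ℝ × ℝ) : 0 ≤ hexNorm p := by
  rw [hexNorm_eq]; exact le_max_of_le_left (abs_nonneg _)

theorem hexNorm_smul (c : ℝ) (p : ℝ × ℝ) : hexNorm (c • p) = |c| * hexNorm p := by
  simp only [hexNorm_eq_half_sum, skewX_smul, skewY_smul, ← mul_add, abs_mul]; ring

@[fun_prop] theorem continuous_hexNorm : Continuous hexNorm := by unfold hexNorm; fun_prop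

/-- An embedding of the plane with the hexagonal norm into a space with a sup norm. -/
noncomputable def hexEmb (p : ℝ × ℝ) : ℝ × ℝ × ℝ := (skewX p, skewY p, skewX p + skewY p)

theorem dist_hexEmb (p q : ℝ × ℝ) : dist (hexEmb p) (hexEmb q) = hexNorm (p - q) := by
  simp only [hexEmb, Prod.dist_eq, Real.dist_eq, hexNorm_eq, skewX_sub, skewY_sub]
  congr 4; ring

theorem edist_hexEmb (p q : ℝ × ℝ) :
    edist (hexEmb p) (hexEmb q) = ENNReal.ofReal (hexNorm (p - q)) := by
  rw [edist_dist, dist_hexEmb]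

/-- Gives access to the additivity of `eVariationOn` over adjacent intervals. -/
theorem hexLength_eq_eVariationOn (γ : ℝ → ℝ × ℝ) :
    hexLength γ = eVariationOn (fun u => hexEmb (γ u)) (Icc 0 1) := by
  simp only [hexLength, eVariationOn, edist_hexEmb, iSup_prod, iSup_subtype, iSup_and]

/-! ### Balls of the norm are regular hexagons -/

/-- The closed ball of the hexagonal norm. -/
def hexBall (v : ℝ × ℝ) (r : ℝ) : Set (ℝ × ℝ) := {p | hexNorm (p - v) ≤ r}

theorem mem_hexBall {p v : ℝ × ℝ} {r : ℝ} : p ∈ hexBall v r ↔ hexNorm (p - v) ≤ r := Iff.rfl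

theorem convex_hexBall (v : ℝ × ℝ) (r : ℝ) : Convex ℝ (hexBall v r) := by
  intro p hp q hq a b ha hb hab
  simp only [hexBall, mem_ofPred_eq, hexNorm_le_iff, abs_le, skewX_sub, skewY_sub, skewX_add,
    skewY_add, skewX_smul, skewY_smul] at *
  obtain rfl : b = 1 - a := by linarith
  refine ⟨⟨?_, ?_⟩, ⟨?_, ?_⟩, ⟨?_, ?_⟩⟩ <;> nlinarith

theorem isClosed_hexBall (v : ℝ × ℝ) (r : ℝ) : IsClosed (hexBall v r) :=
  isClosed_le (by fun_prop) continuous_const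

theorem interior_hexBall (v : ℝ × ℝ) {r : ℝ} (hr : 0 < r) :
    interior (hexBall v r) = {p | hexNorm (p - v) < r} := by
  apply subset_antisymm
  · intro p hp
    refine lt_of_le_of_ne (mem_hexBall.1 (interior_subset hp)) fun h => ?_
    -- A point of norm exactly `r` leaves the ball when pushed radially outwards.
    have hc : Filter.Tendsto (fun c : ℝ => v + c • (p - v)) (nhdsWithin 1 (Ioi 1)) (nhds p) := by
      have : Continuous fun c : ℝ => v + c • (p - v) := by fun_prop
      have := this.tendsto 1
      simp only [one_smul, add_sub_cancel] at this
      exact this.mono_left nhdsWithin_le_nhds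
    have h1 := hc.eventually (mem_interior_iff_mem_nhds.1 hp)
    obtain ⟨c, hc1, hc2⟩ := (h1.and self_mem_nhdsWithin).exists
    rw [add_sub_cancel_left, hexNorm_smul, h] at hc1
    have hc2' : 1 < c := hc2
    rw [abs_of_pos (by linarith)] at hc1
    nlinarith
  · apply interior_maximal
    · intro p hp; rw [mem_ofPred_eq] at hp; exact mem_hexBall.2 hp.le
    · exact isOpen_lt (by fun_prop) continuous_const

theorem frontier_hexBall (v : ℝ × ℝ) {r : ℝ} (hr : 0 < r) :
    frontier (hexBall v r) = {p | hexNorm (p - v) = r} := by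
  rw [(isClosed_hexBall v r).frontier_eq, interior_hexBall v hr]
  ext p; simp only [hexBall, mem_sdiff, mem_ofPred_eq, not_lt]
  exact ⟨fun h => le_antisymm h.1 h.2, fun h => ⟨h.le, h.ge⟩⟩

theorem nonempty_interior_hexBall (v : ℝ × ℝ) {r : ℝ} (hr : 0 < r) :
    (interior (hexBall v r)).Nonempty := by
  rw [interior_hexBall v hr]
  exact ⟨v, by simp [hexNorm, hr]⟩

theorem smul_add_smul_mem_of_zero_mem {C : Set (ℝ × ℝ)} (hC : Convex ℝ C) (h0 : 0 ∈ C)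
    {u w : ℝ × ℝ} (hu : u ∈ C) (hw : w ∈ C) {a b : ℝ} (ha : 0 ≤ a) (hb : 0 ≤ b)
    (hab : a + b ≤ 1) : a • u + b • w ∈ C := by
  rcases (add_nonneg ha hb).eq_or_lt with h | h
  · obtain rfl : a = 0 := by linarith
    obtain rfl : b = 0 := by linarith
    simpa using h0
  · have h1 := hC hu hw (div_nonneg ha h.le) (div_nonneg hb h.le) (by field_simp)
    have h2 := hC.smul_mem_of_zero_mem h0 h1 ⟨h.le, hab⟩
    convert h2 using 1
    rw [smul_add, smul_smul, smul_smul, mul_div_cancel₀ _ h.ne', mul_div_cancel₀ _ h.ne']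

theorem hexBall_eq_regularHexagon : {p : ℝ × ℝ | hexNorm p ≤ 1} = regularHexagon := by
  have hv : ({(1, 0), (1 / 2, √3 / 2), (-1 / 2, √3 / 2), (-1, 0), (-1 / 2, -√3 / 2),
      (1 / 2, -√3 / 2)} : Set (ℝ × ℝ)) = {ofSkew 1 0, ofSkew 0 1, ofSkew (-1) 1,
      ofSkew (-1) 0, ofSkew 0 (-1), ofSkew 1 (-1)} := by
    simp only [ofSkew]; ring_nf
  rw [regularHexagon, hv]
  apply subset_antisymm
  · set C := convexHull ℝ {ofSkew 1 0, ofSkew 0 1, ofSkew (-1) 1,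
      ofSkew (-1) 0, ofSkew 0 (-1), ofSkew 1 (-1)} with hCdef
    have hC : Convex ℝ C := convex_convexHull _ _
    have hm : ∀ x ∈ ({ofSkew 1 0, ofSkew 0 1, ofSkew (-1) 1,
      ofSkew (-1) 0, ofSkew 0 (-1), ofSkew 1 (-1)} : Set (ℝ × ℝ)), x ∈ C :=
      fun x hx => subset_convexHull _ _ hx
    have m1 := hm (ofSkew 1 0) (by simp)
    have m2 := hm (ofSkew 0 1) (by simp)
    have m3 := hm (ofSkew (-1) 1) (by simp)
    have m4 := hm (ofSkew (-1) 0) (by simp)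
    have m5 := hm (ofSkew 0 (-1)) (by simp)
    have m6 := hm (ofSkew 1 (-1)) (by simp)
    have h0 : (0 : ℝ × ℝ) ∈ C := by
      convert hC m1 m4 (a := 1 / 2) (b := 1 / 2) (by norm_num) (by norm_num) (by norm_num) using 1
      apply ext_skew <;> (simp; simp [skewX, skewY])
    intro p hp
    simp only [mem_ofPred_eq, hexNorm_le_iff, abs_le] at hp
    obtain ⟨⟨h1, h2⟩, ⟨h3, h4⟩, h5, h6⟩ := hp
    -- The signs of the three coordinates single out one of the six triangles spanned by the center
    -- and two adjacent vertices; `a` and `b` are the coordinates along these vertices.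
    have key : ∀ {u w : ℝ × ℝ} {a b : ℝ}, u ∈ C → w ∈ C → 0 ≤ a → 0 ≤ b → a + b ≤ 1 →
        skewX p = a * skewX u + b * skewX w → skewY p = a * skewY u + b * skewY w → p ∈ C := by
      intro u w a b hu hw ha hb hab hx hy
      convert smul_add_smul_mem_of_zero_mem hC h0 hu hw ha hb hab using 1
      apply ext_skew <;> simp [*]
    rcases le_total 0 (skewX p) with hs | hs <;> rcases le_total 0 (skewY p) with ht | ht <;>
      rcases le_total 0 (skewX p + skewY p) with hst | hst
    · exact key m1 m2 hs ht h6 (by simp) (by simp)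
    · exact key m1 m2 hs ht h6 (by simp) (by simp)
    · exact key (a := skewX p + skewY p) (b := - skewY p) m1 m6 (by linarith) (by linarith)
        (by linarith) (by simp) (by simp)
    · exact key (a := -(skewX p + skewY p)) (b := skewX p) m5 m6 (by linarith) (by linarith)
        (by linarith) (by simp) (by simp)
    · exact key (a := skewX p + skewY p) (b := - skewX p) m2 m3 (by linarith) (by linarith)
        (by linarith) (by simp) (by simp)
    · exact key (a := -(skewX p + skewY p)) (b := skewY p) m4 m3 (by linarith) (by linarith)
        (by linarith) (by simp) (by simp)
    · exact key (a := -skewX p) (b := - skewY p) m4 m5 (by linarith) (by linarith)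
        (by linarith) (by simp) (by simp)
    · exact key (a := -skewX p) (b := - skewY p) m4 m5 (by linarith) (by linarith)
        (by linarith) (by simp) (by simp)
  · apply convexHull_min
    · intro x hx
      simp only [mem_insert_iff, mem_singleton_iff] at hx
      rcases hx with rfl | rfl | rfl | rfl | rfl | rfl <;> simp [hexNorm_le_iff]
    · simpa [hexBall] using convex_hexBall 0 1

/-! ### Areas of hexagons with the three given side directions -/

/-- The hexagon with sides parallel to those of the regular one, given by bounds for the three
skew coordinates. -/
def skewHexagon (a₁ b₁ a₂ b₂ a₃ b₃ : ℝ) : Set (ℝ × ℝ) :=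
  {p | skewX p ∈ Icc a₁ b₁ ∧ skewY p ∈ Icc a₂ b₂ ∧ skewX p + skewY p ∈ Icc a₃ b₃}

theorem integral_max_zero_sub {a b c : ℝ} (h1 : a ≤ c) (h2 : c ≤ b) :
    ∫ x in a..b, max 0 (c - x) = (c - a) ^ 2 / 2 := by
  rw [← intervalIntegral.integral_add_adjacent_intervals (b := c)
    (Continuous.intervalIntegrable (by fun_prop) _ _)
    (Continuous.intervalIntegrable (by fun_prop) _ _)]
  have e1 : ∫ x in a..c, max 0 (c - x) = ∫ x in a..c, (c - x) := by
    apply intervalIntegral.integral_congr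
    intro x hx
    rw [uIcc_of_le h1] at hx
    exact max_eq_right (by linarith [hx.2])
  have e2 : ∫ x in c..b, max 0 (c - x) = ∫ x in c..b, (0 : ℝ) := by
    apply intervalIntegral.integral_congr
    intro x hx
    rw [uIcc_of_le h2] at hx
    exact max_eq_left (by linarith [hx.1])
  rw [e1, e2, intervalIntegral.integral_sub (by simp) (by simp)]
  simp
  ring

theorem integral_max_zero_sub' {a b c : ℝ} (h1 : a ≤ c) (h2 : c ≤ b) :
    ∫ x in a..b, max 0 (x - c) = (b - c) ^ 2 / 2 := by
  have h := intervalIntegral.integral_comp_neg (a := a) (b := b) fun x => max 0 (-c - x)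
  rw [integral_max_zero_sub (by linarith) (by linarith)] at h
  convert h using 1
  · apply intervalIntegral.integral_congr
    intro x _
    simp only; congr 1; ring
  · ring

theorem integral_fiber {a₁ b₁ a₂ b₂ a₃ b₃ : ℝ} (h1 : a₁ + a₂ ≤ a₃) (h2 : a₃ ≤ b₁ + a₂)
    (h3 : a₁ + b₂ ≤ b₃) (h4 : b₃ ≤ b₁ + b₂) :
    ∫ x in a₁..b₁, (min b₂ (b₃ - x) - max a₂ (a₃ - x)) =
      (b₁ - a₁) * (b₂ - a₂) - (a₃ - a₁ - a₂) ^ 2 / 2 - (b₁ + b₂ - b₃) ^ 2 / 2 := by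
  -- A vertical chord of the box is shortened only where it meets one of the two cut corners; each
  -- corner contributes a right isosceles triangle.
  have e : ∀ x, min b₂ (b₃ - x) - max a₂ (a₃ - x) =
      (b₂ - a₂) - max 0 (x - (b₃ - b₂)) - max 0 ((a₃ - a₂) - x) := by
    intro x
    simp only [max_def, min_def]; grind
  simp only [e]
  rw [intervalIntegral.integral_sub (Continuous.intervalIntegrable (by fun_prop) _ _)
    (Continuous.intervalIntegrable (by fun_prop) _ _),
    intervalIntegral.integral_sub (Continuous.intervalIntegrable (by fun_prop) _ _)
    (Continuous.intervalIntegrable (by fun_prop) _ _),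
    integral_max_zero_sub (by linarith) (by linarith),
    integral_max_zero_sub' (by linarith) (by linarith)]
  simp only [intervalIntegral.integral_const, smul_eq_mul]
  ring

/-- The hypotheses say that each oblique line cuts a triangle off one corner of the box, with legs
no longer than the sides, and that the two triangles do not overlap. -/
theorem volume_truncated_box {a₁ b₁ a₂ b₂ a₃ b₃ : ℝ} (h12 : a₂ ≤ b₂) (h33 : a₃ ≤ b₃)
    (h1 : a₁ + a₂ ≤ a₃) (h2 : a₃ ≤ b₁ + a₂) (h2' : a₃ ≤ a₁ + b₂)
    (h3 : a₁ + b₂ ≤ b₃) (h3' : b₁ + a₂ ≤ b₃) (h4 : b₃ ≤ b₁ + b₂) :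
    volume {q : ℝ × ℝ | q.1 ∈ Icc a₁ b₁ ∧ q.2 ∈ Icc a₂ b₂ ∧ q.1 + q.2 ∈ Icc a₃ b₃} =
      ENNReal.ofReal
        ((b₁ - a₁) * (b₂ - a₂) - (a₃ - a₁ - a₂) ^ 2 / 2 - (b₁ + b₂ - b₃) ^ 2 / 2) := by
  have hab : a₁ ≤ b₁ := by linarith
  rw [← integral_fiber h1 h2 h3 h4, intervalIntegral.integral_of_le hab,
    ← integral_Icc_eq_integral_Ioc, ofReal_integral_eq_lintegral_ofReal]
  · rw [Measure.volume_eq_prod, Measure.prod_apply, ← lintegral_indicator measurableSet_Icc]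
    · apply lintegral_congr
      intro x
      by_cases hx : x ∈ Icc a₁ b₁
      · rw [indicator_of_mem hx, ← Real.volume_Icc]
        congr 1
        ext y
        simp only [mem_preimage, mem_ofPred_eq, mem_Icc, max_le_iff, le_min_iff] at hx ⊢
        grind
      · rw [indicator_of_notMem hx]
        convert measure_empty (μ := (volume : Measure ℝ))
        ext y
        exact ⟨fun h => hx h.1, False.elim⟩
    · apply IsClosed.measurableSet
      refine IsClosed.and ?_ (IsClosed.and ?_ ?_)
      · exact isClosed_Icc.preimage continuous_fst
      · exact isClosed_Icc.preimage continuous_snd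
      · exact isClosed_Icc.preimage (continuous_fst.add continuous_snd)
  · exact (Continuous.integrableOn_Icc (by fun_prop))
  · refine (ae_restrict_iff' measurableSet_Icc).2 (Filter.Eventually.of_forall fun x hx => ?_)
    simp only [Pi.zero_apply, sub_nonneg, max_le_iff, le_min_iff]
    have := hx.1
    have := hx.2
    refine ⟨⟨?_, ?_⟩, ?_, ?_⟩ <;> linarith

theorem volume_preimage_skew (B : Set (ℝ × ℝ)) :
    volume {p : ℝ × ℝ | (skewX p, skewY p) ∈ B} = ENNReal.ofReal (√3 / 2) * volume B := by
  have h3 := sqrt_three_pos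
  set f := Matrix.toLin (Module.Basis.finTwoProd ℝ) (Module.Basis.finTwoProd ℝ)
    !![1, -(1 / √3); 0, 2 / √3] with hf
  have hdet : LinearMap.det f = 2 / √3 := by
    rw [hf, LinearMap.det_toLin, Matrix.det_fin_two_of]; simp
  have hfx : ∀ p, f p = (skewX p, skewY p) := by
    intro p
    rw [hf, Matrix.toLin_finTwoProd_apply]
    simp only [skewX, skewY]
    ring_nf
  have := Measure.addHaar_preimage_linearMap (volume : Measure (ℝ × ℝ)) (f := f)
    (by rw [hdet]; positivity) B
  rw [hdet, abs_of_pos (by positivity), inv_div] at this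
  rw [← this]
  congr 1
  ext p; simp [hfx]

theorem volume_skewHexagon {a₁ b₁ a₂ b₂ a₃ b₃ : ℝ} (h12 : a₂ ≤ b₂) (h33 : a₃ ≤ b₃)
    (h1 : a₁ + a₂ ≤ a₃) (h2 : a₃ ≤ b₁ + a₂) (h2' : a₃ ≤ a₁ + b₂)
    (h3 : a₁ + b₂ ≤ b₃) (h3' : b₁ + a₂ ≤ b₃) (h4 : b₃ ≤ b₁ + b₂) :
    volume (skewHexagon a₁ b₁ a₂ b₂ a₃ b₃) = ENNReal.ofReal (√3 / 2 *
        ((b₁ - a₁) * (b₂ - a₂) - (a₃ - a₁ - a₂) ^ 2 / 2 - (b₁ + b₂ - b₃) ^ 2 / 2)) := by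
  rw [ENNReal.ofReal_mul (by positivity), ← volume_truncated_box h12 h33 h1 h2 h2' h3 h3' h4,
    ← volume_preimage_skew]
  rfl

theorem hexBall_eq_skewHexagon (v : ℝ × ℝ) (r : ℝ) :
    hexBall v r = skewHexagon (skewX v - r) (skewX v + r) (skewY v - r) (skewY v + r)
      (skewX v + skewY v - r) (skewX v + skewY v + r) := by
  ext p
  simp only [hexBall, skewHexagon, mem_ofPred_eq, hexNorm_le_iff, abs_le, mem_Icc, skewX_sub,
    skewY_sub]
  constructor <;> rintro ⟨⟨_, _⟩, ⟨_, _⟩, _, _⟩ <;> refine ⟨⟨?_, ?_⟩, ⟨?_, ?_⟩, ?_, ?_⟩ <;>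
    linarith

theorem volume_hexBall (v : ℝ × ℝ) {r : ℝ} (hr : 0 ≤ r) :
    volume (hexBall v r) = ENNReal.ofReal (√3 / 2 * (3 * r ^ 2)) := by
  rw [hexBall_eq_skewHexagon, volume_skewHexagon] <;> first | linarith | (congr 2; ring)

/-- The side length of the regular hexagon of area 1. -/
noncomputable def unitSide : ℝ := (√(volume regularHexagon).toReal)⁻¹

theorem volume_regularHexagon : (volume regularHexagon).toReal = √3 / 2 * 3 := by
  have h := volume_hexBall 0 zero_le_one
  simp only [hexBall, sub_zero, hexBall_eq_regularHexagon] at h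
  rw [h, ENNReal.toReal_ofReal (by positivity)]; ring

theorem unitSide_pos : 0 < unitSide := by
  rw [unitSide, volume_regularHexagon]; have := sqrt_three_pos; positivity

theorem unitSide_sq : √3 / 2 * (3 * unitSide ^ 2) = 1 := by
  have h3 := sqrt_three_pos
  rw [unitSide, volume_regularHexagon, inv_pow, Real.sq_sqrt (by positivity)]
  field_simp

theorem volume_hexBall_unitSide (v : ℝ × ℝ) : volume (hexBall v unitSide) = 1 := by
  rw [volume_hexBall v unitSide_pos.le, unitSide_sq, ENNReal.ofReal_one]

theorem unitAreaHexagonAt_eq (v : ℝ × ℝ) : unitAreaHexagonAt v = hexBall v unitSide := by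
  ext p
  have hr := unitSide_pos
  change p ∈ (fun p => v + p) '' (unitSide • regularHexagon) ↔ hexNorm (p - v) ≤ unitSide
  rw [← hexBall_eq_regularHexagon, image_add_left, mem_preimage,
    mem_smul_set_iff_inv_smul_mem₀ hr.ne', mem_ofPred_eq, hexNorm_smul,
    abs_of_pos (by positivity), neg_add_eq_sub, inv_mul_le_one₀ hr]

/-! ### The length of a closed curve bounds its widths -/

theorem exists_partition {S : Finset ℝ} (hS : ∀ x ∈ S, x ∈ Icc (0 : ℝ) 1) (h0 : 0 ∈ S)
    (h1 : 1 ∈ S) : ∃ (n : ℕ) (t : ℕ → ℝ), Monotone t ∧ (∀ i, t i ∈ Icc (0 : ℝ) 1) ∧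
      t 0 = 0 ∧ t n = 1 ∧ ∀ x ∈ S, ∃ i ≤ n, t i = x := by
  have hpos : 0 < S.card := Finset.card_pos.2 ⟨0, h0⟩
  set e := S.orderEmbOfFin rfl
  -- Clamping the index keeps the sequence monotone on all of `ℕ`, as `hexLength` demands.
  set t : ℕ → ℝ := fun i => e ⟨min i (S.card - 1), by omega⟩
  have hmono : Monotone t := fun i j hij =>
    e.monotone (by simpa [Fin.le_def] using Or.inl hij)
  have hmem : ∀ i, t i ∈ Icc (0 : ℝ) 1 := fun i => hS _ (Finset.orderEmbOfFin_mem _ _ _)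
  have hex : ∀ x ∈ S, ∃ i ≤ S.card - 1, t i = x := by
    intro x hx
    have : x ∈ range e := by rw [Finset.range_orderEmbOfFin]; exact hx
    obtain ⟨i, rfl⟩ := this
    have hi : (i : ℕ) ≤ S.card - 1 := by omega
    refine ⟨i, hi, ?_⟩
    simp only [t, min_eq_left hi]
  refine ⟨S.card - 1, t, hmono, hmem, ?_, ?_, hex⟩
  · obtain ⟨i, -, hi⟩ := hex 0 h0
    exact le_antisymm (hi ▸ hmono (Nat.zero_le i)) (hmem 0).1
  · obtain ⟨i, hin, hi⟩ := hex 1 h1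
    exact le_antisymm (hmem _).2 (hi ▸ hmono hin)

/-- A closed cycle joins any two of its points by two paths: directly, and around through the common
value at `0` and `n`. -/
theorem two_mul_dist_le_sum_dist {f : ℕ → ℝ} {n : ℕ} (hf : f 0 = f n) {i j : ℕ} (hi : i ≤ n)
    (hj : j ≤ n) : 2 * |f i - f j| ≤ ∑ k ∈ Finset.range n, |f (k + 1) - f k| := by
  wlog hij : i ≤ j generalizing i j
  · rw [abs_sub_comm]; exact this hj hi (by omega)
  have h1 := dist_le_Ico_sum_dist f (Nat.zero_le i)
  have h2 := dist_le_Ico_sum_dist f hij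
  have h3 := dist_le_Ico_sum_dist f hj
  have hs : ∑ k ∈ Finset.range n, |f (k + 1) - f k| = ∑ k ∈ Finset.Ico 0 n,
      dist (f k) (f (k + 1)) := by
    rw [Finset.range_eq_Ico]
    exact Finset.sum_congr rfl fun k _ => by rw [Real.dist_eq, abs_sub_comm]
  rw [hs, ← Finset.sum_Ico_consecutive _ (Nat.zero_le i) hi,
    ← Finset.sum_Ico_consecutive _ hij hj]
  rw [Real.dist_eq] at h1 h2 h3
  have h4 : |f i - f j| ≤ |f 0 - f i| + |f j - f n| := by
    rw [hf, abs_sub_comm (f n), abs_sub_comm (f j)]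
    exact abs_sub_le _ _ _
  linarith

/-- A closed curve is at least as long as the sum of its widths in the three skew coordinates. -/
theorem ofReal_widths_le_hexLength {γ : ℝ → ℝ × ℝ} (hγ : γ 0 = γ 1) {p₁ q₁ p₂ q₂ p₃ q₃ : ℝ × ℝ}
    (hp₁ : p₁ ∈ γ '' Icc 0 1) (hq₁ : q₁ ∈ γ '' Icc 0 1) (hp₂ : p₂ ∈ γ '' Icc 0 1)
    (hq₂ : q₂ ∈ γ '' Icc 0 1) (hp₃ : p₃ ∈ γ '' Icc 0 1) (hq₃ : q₃ ∈ γ '' Icc 0 1) :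
    ENNReal.ofReal (|skewX p₁ - skewX q₁| + |skewY p₂ - skewY q₂| +
      |(skewX p₃ + skewY p₃) - (skewX q₃ + skewY q₃)|) ≤ hexLength γ := by
  obtain ⟨a₁, ha₁, rfl⟩ := hp₁
  obtain ⟨b₁, hb₁, rfl⟩ := hq₁
  obtain ⟨a₂, ha₂, rfl⟩ := hp₂
  obtain ⟨b₂, hb₂, rfl⟩ := hq₂
  obtain ⟨a₃, ha₃, rfl⟩ := hp₃
  obtain ⟨b₃, hb₃, rfl⟩ := hq₃
  -- A single partition through all six parameters serves the three coordinates simultaneously.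
  obtain ⟨n, t, hmono, hmem, ht0, htn, hex⟩ := exists_partition
    (S := {0, 1, a₁, b₁, a₂, b₂, a₃, b₃}) (by
      intro x hx
      simp only [Finset.mem_insert, Finset.mem_singleton] at hx
      rcases hx with rfl | rfl | rfl | rfl | rfl | rfl | rfl | rfl <;>
        first | assumption | simp) (by simp) (by simp)
  have key : ∀ (g : ℝ × ℝ → ℝ), ∀ a ∈ ({0, 1, a₁, b₁, a₂, b₂, a₃, b₃} : Finset ℝ),
      ∀ b ∈ ({0, 1, a₁, b₁, a₂, b₂, a₃, b₃} : Finset ℝ), 2 * |g (γ a) - g (γ b)| ≤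
      ∑ k ∈ Finset.range n, |g (γ (t (k + 1))) - g (γ (t k))| := by
    intro g a ha b hb
    obtain ⟨i, hi, rfl⟩ := hex a ha
    obtain ⟨j, hj, rfl⟩ := hex b hb
    exact two_mul_dist_le_sum_dist (f := fun k => g (γ (t k))) (by simp only [ht0, htn, hγ]) hi hj
  have h1 := key skewX a₁ (by simp) b₁ (by simp)
  have h2 := key skewY a₂ (by simp) b₂ (by simp)
  have h3 := key (fun p => skewX p + skewY p) a₃ (by simp) b₃ (by simp)
  have hle : ENNReal.ofReal (∑ i ∈ Finset.range n, hexNorm (γ (t (i + 1)) - γ (t i))) ≤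
      hexLength γ := by
    rw [ENNReal.ofReal_sum_of_nonneg fun i _ => hexNorm_nonneg _]
    exact le_iSup₂_of_le n t (le_iSup₂_of_le hmono hmem le_rfl)
  refine le_trans (ENNReal.ofReal_le_ofReal ?_) hle
  -- The half in the half-sum formula cancels against the factor 2 in `key`.
  have hsum : ∑ i ∈ Finset.range n, hexNorm (γ (t (i + 1)) - γ (t i)) =
      (∑ k ∈ Finset.range n, |skewX (γ (t (k + 1))) - skewX (γ (t k))| +
      ∑ k ∈ Finset.range n, |skewY (γ (t (k + 1))) - skewY (γ (t k))| +
      ∑ k ∈ Finset.range n, |(skewX (γ (t (k + 1))) + skewY (γ (t (k + 1)))) -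
        (skewX (γ (t k)) + skewY (γ (t k)))|) / 2 := by
    rw [← Finset.sum_add_distrib, ← Finset.sum_add_distrib, Finset.sum_div]
    refine Finset.sum_congr rfl fun k _ => ?_
    rw [hexNorm_eq_half_sum, skewX_sub, skewY_sub]
    congr 3; ring
  rw [hsum]
  linarith

/-! ### Frontiers, boundedness and extremal points -/

theorem subset_interior_or_disjoint_closure {X : Type*} [TopologicalSpace X] {A V : Set X}
    (hV : IsPreconnected V) (h : Disjoint V (frontier A)) :
    V ⊆ interior A ∨ Disjoint V (closure A) := by
  rw [← subset_compl_iff_disjoint_right]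
  by_contra! hcon
  refine absurd (hV.subset_or_subset isOpen_interior isClosed_closure.isOpen_compl ?_ ?_)
    (by simpa using hcon)
  · exact disjoint_compl_right_iff_subset.2 interior_subset_closure
  · intro x hx
    by_cases hc : x ∈ closure A
    · by_cases hi : x ∈ interior A
      · exact Or.inl hi
      · exact absurd ⟨hc, hi⟩ (disjoint_left.1 h hx)
    · exact Or.inr hc

/-- The complement of a sup-norm ball is a union of four half-planes. Each is connected, misses the
frontier and has infinite measure, so it cannot lie in `A` and must be disjoint from it. -/
theorem isBounded_of_isBounded_frontier {A : Set (ℝ × ℝ)} (hA : volume A ≠ ⊤)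
    (hf : Bornology.IsBounded (frontier A)) : Bornology.IsBounded A := by
  obtain ⟨R, hR⟩ := hf.subset_closedBall 0
  have key : ∀ V : Set (ℝ × ℝ), Convex ℝ V → volume V = ⊤ →
      (∀ p ∈ V, R < ‖p‖) → ∀ p ∈ A, p ∉ V := by
    intro V hV hvol hVR p hp hpV
    have hdisj : Disjoint V (frontier A) := by
      rw [disjoint_left]
      intro x hx hxA
      have := hR hxA
      rw [mem_closedBall_zero_iff] at this
      exact absurd (hVR x hx) (not_lt.2 this)
    rcases subset_interior_or_disjoint_closure hV.isPreconnected hdisj with h | h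
    · exact hA (top_le_iff.1 (hvol ▸ measure_mono (h.trans interior_subset)))
    · exact disjoint_left.1 h hpV (subset_closure hp)
  have hprod : ∀ s t : Set ℝ, volume s = ⊤ → volume t = ⊤ → volume (s ×ˢ t) = ⊤ := by
    intro s t hs ht
    rw [Measure.volume_eq_prod, Measure.prod_prod, hs, ht, ENNReal.top_mul_top]
  refine (Metric.isBounded_closedBall (x := (0 : ℝ × ℝ)) (r := R)).subset fun p hp => ?_
  have k1 := key (Ioi R ×ˢ univ) ((convex_Ioi R).prod convex_univ)
    (hprod _ _ Real.volume_Ioi Real.volume_univ)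
    (fun q hq => (lt_of_lt_of_le hq.1 (le_abs_self _)).trans_le (norm_fst_le q)) p hp
  have k2 := key (univ ×ˢ Ioi R) (convex_univ.prod (convex_Ioi R))
    (hprod _ _ Real.volume_univ Real.volume_Ioi)
    (fun q hq => (lt_of_lt_of_le hq.2 (le_abs_self _)).trans_le (norm_snd_le q)) p hp
  have k3 := key (Iio (-R) ×ˢ univ) ((convex_Iio _).prod convex_univ)
    (hprod _ _ Real.volume_Iio Real.volume_univ)
    (fun q hq => (lt_of_lt_of_le (lt_neg.1 hq.1) (neg_le_abs _)).trans_le (norm_fst_le q)) p hp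
  have k4 := key (univ ×ˢ Iio (-R)) (convex_univ.prod (convex_Iio _))
    (hprod _ _ Real.volume_univ Real.volume_Iio)
    (fun q hq => (lt_of_lt_of_le (lt_neg.1 hq.2) (neg_le_abs _)).trans_le (norm_snd_le q)) p hp
  simp only [mem_prod, mem_Ioi, mem_Iio, mem_univ, and_true, true_and, not_lt] at k1 k2 k3 k4
  rw [mem_closedBall_zero_iff, Prod.norm_def, max_le_iff, Real.norm_eq_abs, Real.norm_eq_abs,
    abs_le, abs_le]
  exact ⟨⟨k3, k1⟩, k4, k2⟩

/-- A continuous function which increases along some direction attains its maximum over the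
closure of a bounded set on the frontier. -/
theorem exists_frontier_isMaxOn {A : Set (ℝ × ℝ)} (hA : Bornology.IsBounded A)
    (hne : A.Nonempty) {g : ℝ × ℝ → ℝ} (hg : Continuous g) {d : ℝ × ℝ}
    (hd : ∀ p, ∀ c > (0 : ℝ), g p < g (p + c • d)) :
    ∃ p ∈ frontier A, ∀ q ∈ closure A, g q ≤ g p := by
  obtain ⟨p, hp, hmax⟩ := hA.isCompact_closure.exists_isMaxOn hne.closure hg.continuousOn
  refine ⟨p, ⟨hp, fun hint => ?_⟩, hmax⟩
  have hc : Filter.Tendsto (fun c : ℝ => p + c • d) (nhdsWithin 0 (Ioi 0)) (nhds p) := by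
    have : Continuous fun c : ℝ => p + c • d := by fun_prop
    have := this.tendsto 0
    simp only [zero_smul, add_zero] at this
    exact this.mono_left nhdsWithin_le_nhds
  obtain ⟨c, hc1, hc2⟩ := ((hc.eventually (mem_interior_iff_mem_nhds.1 hint)).and
    self_mem_nhdsWithin).exists
  exact absurd (hmax (subset_closure hc1)) (not_le.2 (hd p c hc2))

/-! ### Variation of curves through separated points -/

/-- A lower bound for the length of a curve on `[a, b]` passing through separated points. -/
theorem exists_first_last_le_eVariationOn {E : Type*} [PseudoEMetricSpace E] (f : ℝ → E) {r : ℝ≥0∞}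
    (a : ℝ) (T : Finset ℝ) (hne : T.Nonempty) (hT : ∀ x ∈ T, a ≤ x)
    (hsep : ∀ x ∈ T, ∀ y ∈ T, x ≠ y → r ≤ edist (f x) (f y)) :
    ∃ c ∈ T, ∃ d ∈ T, (2 ≤ T.card → c ≠ d) ∧ (∀ x ∈ T, c ≤ x ∧ x ≤ d) ∧
      edist (f a) (f c) + (T.card - 1 : ℕ) * r ≤ eVariationOn f (Icc a d) := by
  -- A new rightmost parameter `m` adds one gap, from the previous last parameter `d` to `m`.
  induction T using Finset.induction_on_max with
  | empty => exact absurd hne Finset.not_nonempty_empty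
  | insert m T hm ih =>
    have hmT : m ∉ T := fun h => lt_irrefl _ (hm m h)
    have ham : a ≤ m := hT m (Finset.mem_insert_self _ _)
    rcases T.eq_empty_or_nonempty with rfl | hT'
    · refine ⟨m, by simp, m, by simp, by simp, by simp, ?_⟩
      simpa using eVariationOn.edist_le f (left_mem_Icc.2 ham) (right_mem_Icc.2 ham)
    · obtain ⟨c, hc, d, hd, -, hcd, hlen⟩ := ih hT' (fun x hx => hT x (Finset.mem_insert_of_mem hx))
        (fun x hx y hy => hsep x (Finset.mem_insert_of_mem hx) y (Finset.mem_insert_of_mem hy))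
      refine ⟨c, Finset.mem_insert_of_mem hc, m, Finset.mem_insert_self _ _,
        fun _ => (hm c hc).ne, ?_, ?_⟩
      · intro x hx
        rcases Finset.mem_insert.1 hx with rfl | hx
        · exact ⟨(hm c hc).le, le_rfl⟩
        · exact ⟨(hcd x hx).1, (hm x hx).le⟩
      · have had : a ≤ d := hT d (Finset.mem_insert_of_mem hd)
        have hdm := (hm d hd).le
        have hadd := eVariationOn.Icc_add_Icc f (s := univ) had hdm (mem_univ d)
        simp only [univ_inter] at hadd
        have h1 := eVariationOn.edist_le f (left_mem_Icc.2 hdm) (right_mem_Icc.2 hdm)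
        have h2 := hsep d (Finset.mem_insert_of_mem hd) m (Finset.mem_insert_self _ _)
          (hm d hd).ne
        have hcard : (insert m T).card - 1 = (T.card - 1) + 1 := by
          rw [Finset.card_insert_of_notMem hmT]
          have := hT'.card_pos
          omega
        rw [hcard, ← hadd]
        rw [Nat.cast_add, Nat.cast_one, add_mul, one_mul, ← add_assoc]
        exact add_le_add hlen (h2.trans h1)

theorem exists_first_last_le_eVariationOn_Icc {E : Type*} [PseudoEMetricSpace E] (f : ℝ → E)
    {r : ℝ≥0∞} {a b : ℝ} (T : Finset ℝ) (hne : T.Nonempty) (hT : ∀ x ∈ T, x ∈ Icc a b)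
    (hsep : ∀ x ∈ T, ∀ y ∈ T, x ≠ y → r ≤ edist (f x) (f y)) :
    ∃ c ∈ T, ∃ d ∈ T, (2 ≤ T.card → c ≠ d) ∧
      edist (f a) (f c) + (T.card - 1 : ℕ) * r + edist (f d) (f b) ≤
        eVariationOn f (Icc a b) := by
  obtain ⟨c, hc, d, hd, hne', -, hlen⟩ :=
    exists_first_last_le_eVariationOn f a T hne (fun x hx => (hT x hx).1) hsep
  refine ⟨c, hc, d, hd, hne', ?_⟩
  have hadd := eVariationOn.Icc_add_Icc f (s := univ) (hT d hd).1 (hT d hd).2 (mem_univ d)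
  simp only [univ_inter] at hadd
  rw [← hadd]
  exact add_le_add hlen
    (eVariationOn.edist_le f (left_mem_Icc.2 (hT d hd).2) (right_mem_Icc.2 (hT d hd).2))

/-- On a closed curve through `k ≥ 2` separated points, every further point lies between two
consecutive ones; the detour through it bounds the length from below. -/
theorem exists_neighbors_le_eVariationOn {E : Type*} [PseudoEMetricSpace E] (f : ℝ → E)
    {r : ℝ≥0∞} {a b τ : ℝ} (hf : f a = f b) (T : Finset ℝ) (hcard : 2 ≤ T.card)
    (hT : ∀ x ∈ T, x ∈ Icc a b) (hτ : τ ∈ Icc a b) (hτT : τ ∉ T)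
    (hsep : ∀ x ∈ T, ∀ y ∈ T, x ≠ y → r ≤ edist (f x) (f y)) :
    ∃ c ∈ T, ∃ d ∈ T, c ≠ d ∧
      edist (f c) (f τ) + edist (f τ) (f d) + (T.card - 1 : ℕ) * r ≤
        eVariationOn f (Icc a b) := by
  have hadd := eVariationOn.Icc_add_Icc f (s := univ) hτ.1 hτ.2 (mem_univ τ)
  simp only [univ_inter] at hadd
  rw [← hadd]
  set T₁ := T.filter (· < τ) with hT₁
  set T₂ := T.filter (¬ · < τ) with hT₂
  have hc : T₁.card + T₂.card = T.card := Finset.card_filter_add_card_filter_not _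
  have hs₁ : ∀ x ∈ T₁, x ∈ T ∧ x < τ := fun x hx => Finset.mem_filter.1 hx
  have hs₂ : ∀ x ∈ T₂, x ∈ T ∧ τ < x := fun x hx => by
    have h := Finset.mem_filter.1 hx
    exact ⟨h.1, lt_of_le_of_ne (not_lt.1 h.2) fun h' => hτT (h' ▸ h.1)⟩
  have hI₁ : ∀ x ∈ T₁, x ∈ Icc a τ := fun x hx => ⟨(hT x (hs₁ x hx).1).1, (hs₁ x hx).2.le⟩
  have hI₂ : ∀ x ∈ T₂, x ∈ Icc τ b := fun x hx => ⟨(hs₂ x hx).2.le, (hT x (hs₂ x hx).1).2⟩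
  have hsep₁ : ∀ x ∈ T₁, ∀ y ∈ T₁, x ≠ y → r ≤ edist (f x) (f y) :=
    fun x hx y hy => hsep x (hs₁ x hx).1 y (hs₁ y hy).1
  have hsep₂ : ∀ x ∈ T₂, ∀ y ∈ T₂, x ≠ y → r ≤ edist (f x) (f y) :=
    fun x hx y hy => hsep x (hs₂ x hx).1 y (hs₂ y hy).1
  -- With no parameter before `τ`, its predecessor on the cycle is the last one, reached backwards
  -- through `f a = f b`.
  rcases T₁.eq_empty_or_nonempty with h₁ | h₁
  · have hcc : T₂.card = T.card := by simpa [h₁] using hc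
    obtain ⟨c, hcT, d, hdT, hcd, hlen⟩ := exists_first_last_le_eVariationOn_Icc f T₂
      (Finset.card_pos.1 (by omega)) hI₂ hsep₂
    refine ⟨d, (hs₂ d hdT).1, c, (hs₂ c hcT).1, (hcd (by omega)).symm, ?_⟩
    have h1 := eVariationOn.edist_le f (left_mem_Icc.2 hτ.1) (right_mem_Icc.2 hτ.1)
    have h2 := edist_triangle (f d) (f b) (f τ)
    rw [hf] at h1
    rw [hcc] at hlen
    calc _ ≤ (edist (f d) (f b) + edist (f b) (f τ)) + edist (f τ) (f c)
            + (T.card - 1 : ℕ) * r := by gcongr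
      _ = edist (f b) (f τ) + (edist (f τ) (f c) + (T.card - 1 : ℕ) * r
            + edist (f d) (f b)) := by ring
      _ ≤ _ := add_le_add h1 hlen
  · rcases T₂.eq_empty_or_nonempty with h₂ | h₂
    · have hcc : T₁.card = T.card := by simpa [h₂] using hc
      obtain ⟨c, hcT, d, hdT, hcd, hlen⟩ := exists_first_last_le_eVariationOn_Icc f T₁ h₁ hI₁ hsep₁
      refine ⟨d, (hs₁ d hdT).1, c, (hs₁ c hcT).1, (hcd (by omega)).symm, ?_⟩
      have h1 := eVariationOn.edist_le f (left_mem_Icc.2 hτ.2) (right_mem_Icc.2 hτ.2)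
      have h2 := edist_triangle (f τ) (f b) (f c)
      rw [hf, hcc] at hlen
      calc _ ≤ edist (f d) (f τ) + (edist (f τ) (f b) + edist (f b) (f c))
              + (T.card - 1 : ℕ) * r := by gcongr
        _ = (edist (f b) (f c) + (T.card - 1 : ℕ) * r + edist (f d) (f τ)) +
              edist (f τ) (f b) := by ring
        _ ≤ _ := add_le_add hlen h1
    · obtain ⟨c₁, hc₁, d₁, hd₁, -, hlen₁⟩ :=
        exists_first_last_le_eVariationOn_Icc f T₁ h₁ hI₁ hsep₁
      obtain ⟨c₂, hc₂, d₂, hd₂, -, hlen₂⟩ :=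
        exists_first_last_le_eVariationOn_Icc f T₂ h₂ hI₂ hsep₂
      refine ⟨d₁, (hs₁ _ hd₁).1, c₂, (hs₂ _ hc₂).1, ((hs₁ _ hd₁).2.trans (hs₂ _ hc₂).2).ne, ?_⟩
      -- The two sides of `τ` account for `T.card - 2` gaps; the remaining one runs from `d₂`
      -- through the base point to `c₁`.
      have h1 := hsep d₂ (hs₂ _ hd₂).1 c₁ (hs₁ _ hc₁).1 ((hs₁ _ hc₁).2.trans (hs₂ _ hd₂).2).ne'
      have h2 := edist_triangle (f d₂) (f b) (f c₁)
      have hcc : T.card - 1 = (T₁.card - 1) + (T₂.card - 1) + 1 := by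
        have := h₁.card_pos
        have := h₂.card_pos
        omega
      rw [hf] at hlen₁
      rw [hcc, Nat.cast_add, Nat.cast_add, Nat.cast_one]
      calc edist (f d₁) (f τ) + edist (f τ) (f c₂) +
            (((T₁.card - 1 : ℕ) : ℝ≥0∞) + ((T₂.card - 1 : ℕ) : ℝ≥0∞) + 1) * r
          = edist (f d₁) (f τ) + edist (f τ) (f c₂) +
            (((T₁.card - 1 : ℕ) : ℝ≥0∞) + ((T₂.card - 1 : ℕ) : ℝ≥0∞)) * r + r := by ring
        _ ≤ edist (f d₁) (f τ) + edist (f τ) (f c₂) +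
            (((T₁.card - 1 : ℕ) : ℝ≥0∞) + ((T₂.card - 1 : ℕ) : ℝ≥0∞)) * r +
            (edist (f d₂) (f b) + edist (f b) (f c₁)) := by gcongr; exact h1.trans h2
        _ = (edist (f b) (f c₁) + (T₁.card - 1 : ℕ) * r + edist (f d₁) (f τ)) +
            (edist (f τ) (f c₂) + (T₂.card - 1 : ℕ) * r + edist (f d₂) (f b)) := by ring
        _ ≤ _ := add_le_add hlen₁ hlen₂

/-! ### Parametrization of the hexagon's boundary -/

/-- The first skew coordinate of the unit speed parametrization of the boundary of the regular
hexagon over `[0, 6]`. -/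
def boundaryX (u : ℝ) : ℝ := max (-1) (min 1 (max (1 - u) (u - 4)))

/-- The second skew coordinate of that parametrization. -/
def boundaryY (u : ℝ) : ℝ := max (-1) (min 1 (max (min u (3 - u)) (u - 6)))

theorem boundary_cases {u : ℝ} (h0 : 0 ≤ u) (h6 : u ≤ 6) :
    (u ≤ 1 ∧ boundaryX u = 1 - u ∧ boundaryY u = u) ∨
    (1 ≤ u ∧ u ≤ 2 ∧ boundaryX u = 1 - u ∧ boundaryY u = 1) ∨
    (2 ≤ u ∧ u ≤ 3 ∧ boundaryX u = -1 ∧ boundaryY u = 3 - u) ∨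
    (3 ≤ u ∧ u ≤ 4 ∧ boundaryX u = u - 4 ∧ boundaryY u = 3 - u) ∨
    (4 ≤ u ∧ u ≤ 5 ∧ boundaryX u = u - 4 ∧ boundaryY u = -1) ∨
    (5 ≤ u ∧ boundaryX u = 1 ∧ boundaryY u = u - 6) := by
  unfold boundaryX boundaryY
  rcases le_total u 1 with h1 | h1
  · left; grind
  rcases le_total u 2 with h2 | h2
  · right; left; grind
  rcases le_total u 3 with h3 | h3
  · right; right; left; grind
  rcases le_total u 4 with h4 | h4
  · right; right; right; left; grind
  rcases le_total u 5 with h5 | h5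
  · right; right; right; right; left; grind
  · right; right; right; right; right; grind

/-- The third coordinate has the same clamped form as the first two, so the same Lipschitz argument
covers it. -/
theorem boundaryX_add_boundaryY {u : ℝ} (h0 : 0 ≤ u) (h6 : u ≤ 6) :
    boundaryX u + boundaryY u = max (-1) (min 1 (max (2 - u) (u - 5))) := by
  rcases boundary_cases h0 h6 with h | h | h | h | h | h <;> grind

theorem abs_max_sub_max_le {a b c d e : ℝ} (h : |a - c| ≤ e) (h' : |b - d| ≤ e) :
    |max a b - max c d| ≤ e :=
  (abs_max_sub_max_le_max _ _ _ _).trans (max_le h h')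

theorem abs_min_sub_min_le {a b c d e : ℝ} (h : |a - c| ≤ e) (h' : |b - d| ≤ e) :
    |min a b - min c d| ≤ e :=
  (abs_min_sub_min_le_max _ _ _ _).trans (max_le h h')

theorem abs_clamp_sub_clamp_le {x y e : ℝ} (h : |x - y| ≤ e) :
    |max (-1) (min 1 x) - max (-1) (min 1 y)| ≤ e := by
  have he : 0 ≤ e := (abs_nonneg _).trans h
  exact abs_max_sub_max_le (by simpa using he) (abs_min_sub_min_le (by simpa using he) h)

/-- All three coordinates are built by `max` and `min` from functions of slope `±1` and constants,
hence are 1-Lipschitz. -/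
theorem hexNorm_boundary_sub_le {u w : ℝ} (hu0 : 0 ≤ u) (hu6 : u ≤ 6) (hw0 : 0 ≤ w)
    (hw6 : w ≤ 6) : hexNorm (ofSkew (boundaryX u) (boundaryY u) -
      ofSkew (boundaryX w) (boundaryY w)) ≤ |u - w| := by
  have e1 : ∀ c : ℝ, |(c - u) - (c - w)| ≤ |u - w| := fun c => by
    rw [sub_sub_sub_cancel_left, abs_sub_comm]
  have e2 : ∀ c : ℝ, |(u - c) - (w - c)| ≤ |u - w| := fun c => by
    rw [sub_sub_sub_cancel_right]
  rw [hexNorm_le_iff, skewX_sub, skewY_sub]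
  simp only [skewX_ofSkew, skewY_ofSkew]
  refine ⟨?_, ?_, ?_⟩
  · exact abs_clamp_sub_clamp_le (abs_max_sub_max_le (e1 _) (e2 _))
  · exact abs_clamp_sub_clamp_le
      (abs_max_sub_max_le (abs_min_sub_min_le le_rfl (e1 _)) (e2 _))
  · rw [sub_add_sub_comm, boundaryX_add_boundaryY hu0 hu6, boundaryX_add_boundaryY hw0 hw6]
    exact abs_clamp_sub_clamp_le (abs_max_sub_max_le (e1 _) (e2 _))

theorem hexNorm_boundary {u : ℝ} (h0 : 0 ≤ u) (h6 : u ≤ 6) :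
    hexNorm (ofSkew (boundaryX u) (boundaryY u)) = 1 := by
  rw [hexNorm_eq_half_sum, skewX_ofSkew, skewY_ofSkew, div_eq_iff two_ne_zero]
  have h := boundary_cases h0 h6
  rcases le_total 0 (boundaryX u) with hs | hs <;> rcases le_total 0 (boundaryY u) with ht | ht <;>
    rcases le_total 0 (boundaryX u + boundaryY u) with hst | hst <;>
    simp only [abs_of_nonneg, abs_of_nonpos, hs, ht, hst] <;> grind

theorem eq_of_boundary_eq {u w : ℝ} (hu0 : 0 ≤ u) (hu6 : u < 6) (hw0 : 0 ≤ w) (hw6 : w < 6)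
    (hX : boundaryX u = boundaryX w) (hY : boundaryY u = boundaryY w) : u = w := by
  rcases boundary_cases hu0 hu6.le with h | h | h | h | h | h <;>
    rcases boundary_cases hw0 hw6.le with h' | h' | h' | h' | h' | h' <;> grind

theorem exists_boundary_eq {s t : ℝ} (h : hexNorm (ofSkew s t) = 1) :
    ∃ u, 0 ≤ u ∧ u ≤ 6 ∧ boundaryX u = s ∧ boundaryY u = t := by
  have hle := hexNorm_le_iff.1 h.le
  simp only [skewX_ofSkew, skewY_ofSkew, abs_le] at hle
  rw [hexNorm_eq_half_sum, skewX_ofSkew, skewY_ofSkew, div_eq_iff two_ne_zero] at h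
  obtain ⟨⟨hs1, hs2⟩, ⟨ht1, ht2⟩, hst1, hst2⟩ := hle
  -- The signs determine the side; its unit-speed coordinate is then solved for `u`.
  rcases le_total 0 s with hs | hs <;> rcases le_total 0 t with ht | ht <;>
    rcases le_total 0 (s + t) with hst | hst <;>
    simp only [abs_of_nonneg, abs_of_nonpos, hs, ht, hst] at h
  · have := boundary_cases (u := t) (by linarith) (by linarith)
    exact ⟨t, by linarith, by linarith, by grind, by grind⟩
  · exact absurd h (by linarith)
  · have := boundary_cases (u := t + 6) (by linarith) (by linarith)
    exact ⟨t + 6, by linarith, by linarith, by grind, by grind⟩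
  · have := boundary_cases (u := s + 4) (by linarith) (by linarith)
    exact ⟨s + 4, by linarith, by linarith, by grind, by grind⟩
  · have := boundary_cases (u := 1 - s) (by linarith) (by linarith)
    exact ⟨1 - s, by linarith, by linarith, by grind, by grind⟩
  · have := boundary_cases (u := 3 - t) (by linarith) (by linarith)
    exact ⟨3 - t, by linarith, by linarith, by grind, by grind⟩
  · exact absurd h (by linarith)
  · have := boundary_cases (u := 3 - t) (by linarith) (by linarith)
    exact ⟨3 - t, by linarith, by linarith, by grind, by grind⟩

/-- The boundary of the hexagon with center `v` and side `r`, run through at constant speed. -/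
noncomputable def hexCurve (v : ℝ × ℝ) (r : ℝ) (u : ℝ) : ℝ × ℝ :=
  v + r • ofSkew (boundaryX (6 * u)) (boundaryY (6 * u))

theorem continuous_hexCurve (v : ℝ × ℝ) (r : ℝ) : Continuous (hexCurve v r) := by
  unfold hexCurve boundaryX boundaryY ofSkew
  fun_prop

theorem hexLength_hexCurve_le (v : ℝ × ℝ) {r : ℝ} (hr : 0 ≤ r) :
    hexLength (hexCurve v r) ≤ ENNReal.ofReal (6 * r) := by
  refine iSup₂_le fun n t => iSup₂_le fun hmono hmem => ?_
  have hstep : ∀ i, hexNorm (hexCurve v r (t (i + 1)) - hexCurve v r (t i)) ≤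
      6 * r * t (i + 1) - 6 * r * t i := by
    intro i
    have h1 := hmem i
    have h2 := hmem (i + 1)
    have h3 := hmono (Nat.le_succ i)
    rw [hexCurve, hexCurve, add_sub_add_left_eq_sub, ← smul_sub, hexNorm_smul, abs_of_nonneg hr]
    have h4 := hexNorm_boundary_sub_le (u := 6 * t (i + 1)) (w := 6 * t i)
      (by linarith [h2.1]) (by linarith [h2.2]) (by linarith [h1.1]) (by linarith [h1.2])
    rw [abs_of_nonneg (by linarith)] at h4
    nlinarith
  rw [← ENNReal.ofReal_sum_of_nonneg fun i _ => hexNorm_nonneg _]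
  apply ENNReal.ofReal_le_ofReal
  calc _ ≤ ∑ i ∈ Finset.range n, (6 * r * t (i + 1) - 6 * r * t i) :=
        Finset.sum_le_sum fun i _ => hstep i
    _ = 6 * r * t n - 6 * r * t 0 := Finset.sum_range_sub (fun i => 6 * r * t i) n
    _ ≤ 6 * r := by nlinarith [(hmem n).2, (hmem 0).1]

theorem image_hexCurve (v : ℝ × ℝ) {r : ℝ} (hr : 0 < r) :
    hexCurve v r '' Icc 0 1 = {p | hexNorm (p - v) = r} := by
  ext p
  constructor
  · rintro ⟨u, hu, rfl⟩
    rw [mem_ofPred_eq, hexCurve, add_sub_cancel_left, hexNorm_smul, abs_of_pos hr,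
      hexNorm_boundary (by linarith [hu.1]) (by linarith [hu.2]), mul_one]
  · intro hp
    rw [mem_ofPred_eq] at hp
    obtain ⟨u, hu0, hu6, hX, hY⟩ := exists_boundary_eq (s := skewX (r⁻¹ • (p - v)))
      (t := skewY (r⁻¹ • (p - v))) (by
        rw [ofSkew_skew, hexNorm_smul, hp, abs_of_pos (by positivity), inv_mul_cancel₀ hr.ne'])
    refine ⟨u / 6, ⟨by linarith, by linarith⟩, ?_⟩
    rw [hexCurve, mul_div_cancel₀ u (by norm_num : (6 : ℝ) ≠ 0), hX, hY, ofSkew_skew,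
      smul_inv_smul₀ hr.ne', add_sub_cancel]

theorem isBoundaryCurve_hexCurve {A : Set (ℝ × ℝ)} {v : ℝ × ℝ} {r : ℝ} (hr : 0 < r)
    (hA : frontier A = {p | hexNorm (p - v) = r}) : IsBoundaryCurve A (hexCurve v r) where
  continuousOn := (continuous_hexCurve v r).continuousOn
  closed := by
    have h : boundaryX 0 = boundaryX 6 ∧ boundaryY 0 = boundaryY 6 := by
      unfold boundaryX boundaryY; norm_num
    simp [hexCurve, h.1, h.2]
  simple := by
    intro u hu w hw h
    simp only [hexCurve, add_right_inj] at h
    have h' := smul_right_injective _ hr.ne' h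
    have hX := congrArg skewX h'
    have hY := congrArg skewY h'
    simp only [skewX_ofSkew, skewY_ofSkew] at hX hY
    have := eq_of_boundary_eq (u := 6 * u) (w := 6 * w) (by linarith [hu.1]) (by linarith [hu.2])
      (by linarith [hw.1]) (by linarith [hw.2]) hX hY
    linarith
  rectifiable := ((hexLength_hexCurve_le v hr.le).trans_lt ENNReal.ofReal_lt_top).ne
  image_eq := by rw [image_hexCurve v hr, hA]

/-! ### Sets between the open and the closed hexagon -/

theorem frontier_of_interior_hexBall_subset {A : Set (ℝ × ℝ)} {v : ℝ × ℝ} {r : ℝ} (hr : 0 < r)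
    (h1 : interior (hexBall v r) ⊆ A) (h2 : A ⊆ hexBall v r) :
    frontier A = {p | hexNorm (p - v) = r} := by
  have hc : closure A = hexBall v r := by
    apply subset_antisymm (closure_minimal h2 (isClosed_hexBall v r))
    -- A closed convex set with nonempty interior is the closure of that interior.
    rw [← (isClosed_hexBall v r).closure_eq, ← (convex_hexBall v
      r).closure_interior_eq_closure_of_nonempty_interior (nonempty_interior_hexBall v hr)]
    exact closure_mono h1
  have hi : interior A = interior (hexBall v r) :=
    subset_antisymm (interior_mono h2) (interior_maximal h1 isOpen_interior)
  rw [← frontier_hexBall v hr, frontier, hc, hi, (isClosed_hexBall v r).frontier_eq]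

theorem volume_of_interior_hexBall_subset {A : Set (ℝ × ℝ)} {v : ℝ × ℝ}
    (h1 : interior (hexBall v unitSide) ⊆ A) (h2 : A ⊆ hexBall v unitSide) : volume A = 1 := by
  rw [← volume_hexBall_unitSide v]
  apply le_antisymm (measure_mono h2)
  rw [← measure_congr (interior_ae_eq_of_null_frontier
    ((convex_hexBall v unitSide).addHaar_frontier volume))]
  exact measure_mono h1

/-! ### Short closed curves through the six vertices -/

/-- The vertices of the regular hexagon. -/
noncomputable def hexVertex : Fin 6 → ℝ × ℝ :=
  ![ofSkew 1 0, ofSkew 0 1, ofSkew (-1) 1, ofSkew (-1) 0, ofSkew 0 (-1), ofSkew 1 (-1)]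

theorem hexNorm_hexVertex (i : Fin 6) : hexNorm (hexVertex i) = 1 := by
  fin_cases i <;> simp [hexVertex, hexNorm_eq]

/-- The vertices have integral skew coordinates, so distinct ones differ by at least 1 in some
coordinate. -/
theorem one_le_hexNorm_hexVertex_sub {i j : Fin 6} (h : i ≠ j) :
    1 ≤ hexNorm (hexVertex i - hexVertex j) := by
  by_contra! hlt
  simp only [hexNorm_lt_iff, skewX_sub, skewY_sub, abs_lt] at hlt
  fin_cases i <;> fin_cases j <;> first | exact h rfl | (simp [hexVertex] at hlt; done) |
    (simp [hexVertex] at hlt; linarith)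

/-- Only boundary points of the hexagon lie on a shortest path between adjacent vertices. -/
theorem one_le_hexNorm_of_between {i j : Fin 6} (h : i ≠ j) {y : ℝ × ℝ}
    (hy : hexNorm (hexVertex i - y) + hexNorm (y - hexVertex j) ≤ 1) : 1 ≤ hexNorm y := by
  by_contra! hlt
  have h1 := hexNorm_le_iff.1 (le_refl (hexNorm (hexVertex i - y)))
  have h2 := hexNorm_le_iff.1 (le_refl (hexNorm (y - hexVertex j)))
  simp only [hexNorm_lt_iff, abs_lt] at hlt
  simp only [skewX_sub, skewY_sub, abs_le] at h1 h2
  generalize hexNorm (hexVertex i - y) = d at *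
  generalize hexNorm (y - hexVertex j) = e at *
  obtain ⟨⟨_, _⟩, ⟨_, _⟩, _, _⟩ := hlt
  obtain ⟨⟨_, _⟩, ⟨_, _⟩, _, _⟩ := h1
  obtain ⟨⟨_, _⟩, ⟨_, _⟩, _, _⟩ := h2
  -- For the vertices `(1, 0)` and `(0, 1)` in skew coordinates, adding `1 - s ≤ d` and `1 - t ≤ e`
  -- gives `s + t ≥ 1`; the other sides are alike. Nonadjacent vertices are at distance 2,
  -- contradicting `d + e ≤ 1`.
  fin_cases i <;> fin_cases j <;> first | exact h rfl | (simp [hexVertex] at *; linarith)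

/-- A closed curve of length at most `6 * r` through the vertices of a hexagon of side `r` stays
outside of the interior of the hexagon. -/
theorem le_hexNorm_of_vertices_mem {γ : ℝ → ℝ × ℝ} (hγ : γ 0 = γ 1) {v : ℝ × ℝ} {r : ℝ}
    (hr : 0 < r) (hlen : hexLength γ ≤ ENNReal.ofReal (6 * r))
    (hV : ∀ i, v + r • hexVertex i ∈ γ '' Icc 0 1) {x : ℝ × ℝ} (hx : x ∈ γ '' Icc 0 1) :
    r ≤ hexNorm (x - v) := by
  by_contra! hlt
  choose u hu huV using hV
  obtain ⟨τ, hτ, rfl⟩ := hx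
  have hsepV : ∀ i j, i ≠ j → r ≤ hexNorm (γ (u i) - γ (u j)) := by
    intro i j hij
    rw [huV, huV, add_sub_add_left_eq_sub, ← smul_sub, hexNorm_smul, abs_of_pos hr]
    nlinarith [one_le_hexNorm_hexVertex_sub hij]
  have hinj : Function.Injective u := by
    intro i j hij
    by_contra hne
    have := hsepV i j hne
    rw [hij, sub_self, hexNorm_eq] at this
    simp [skewX, skewY] at this
    linarith
  have hcard : (Finset.univ.image u).card = 6 := by
    rw [Finset.card_image_of_injective _ hinj]; simp
  obtain ⟨c, hc, d, hd, hcd, h⟩ := exists_neighbors_le_eVariationOn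
    (fun w => hexEmb (γ w)) (r := ENNReal.ofReal r) (a := 0) (b := 1) (τ := τ)
    (by simp only [hγ]) (Finset.univ.image u) (by omega)
    (by
      intro w hw
      obtain ⟨i, -, rfl⟩ := Finset.mem_image.1 hw
      exact hu i) hτ
    (by
      intro hw
      obtain ⟨i, -, hi⟩ := Finset.mem_image.1 hw
      rw [← hi, huV, add_sub_cancel_left, hexNorm_smul, hexNorm_hexVertex, abs_of_pos hr] at hlt
      linarith)
    (by
      intro w hw z hz hwz
      obtain ⟨i, -, rfl⟩ := Finset.mem_image.1 hw
      obtain ⟨j, -, rfl⟩ := Finset.mem_image.1 hz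
      simp only [edist_hexEmb]
      exact ENNReal.ofReal_le_ofReal (hsepV i j fun h => hwz (h ▸ rfl)))
  obtain ⟨i, -, rfl⟩ := Finset.mem_image.1 hc
  obtain ⟨j, -, rfl⟩ := Finset.mem_image.1 hd
  rw [← hexLength_eq_eVariationOn, hcard] at h
  have h' := h.trans hlen
  -- Five gaps between vertices use up `5 * r`, which leaves at most `r` for the detour through `γ
  -- τ`.
  have h5 : ((6 - 1 : ℕ) : ℝ≥0∞) * ENNReal.ofReal r = ENNReal.ofReal (5 * r) := by
    rw [ENNReal.ofReal_mul (by norm_num)]; norm_num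
  simp only [edist_hexEmb] at h'
  rw [h5, ← ENNReal.ofReal_add (hexNorm_nonneg _) (hexNorm_nonneg _),
    ← ENNReal.ofReal_add (add_nonneg (hexNorm_nonneg _) (hexNorm_nonneg _)) (by positivity),
    ENNReal.ofReal_le_ofReal_iff (by positivity)] at h'
  have hy : γ τ = v + r • (r⁻¹ • (γ τ - v)) := by
    rw [smul_inv_smul₀ hr.ne', add_sub_cancel]
  have hbet := one_le_hexNorm_of_between (i := i) (j := j) (y := r⁻¹ • (γ τ - v))
    (fun h => hcd (h ▸ rfl)) (by
      rw [huV, huV, hy, add_sub_add_left_eq_sub, add_sub_add_left_eq_sub, ← smul_sub, ← smul_sub,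
        hexNorm_smul, hexNorm_smul, abs_of_pos hr] at h'
      nlinarith)
  rw [hexNorm_smul, abs_of_pos (by positivity), le_inv_mul_iff₀ hr] at hbet
  linarith

/-! ### The isoperimetric inequality and its equality case -/

/-- The circumscribed hexagon of a plane set whose boundary is a closed curve. -/
theorem exists_circumscribed_hexagon {A : Set (ℝ × ℝ)} {γ : ℝ → ℝ × ℝ} (hγ : IsBoundaryCurve A γ)
    (hA : volume A = 1) : ∃ a₁ b₁ a₂ b₂ a₃ b₃ : ℝ, closure A ⊆ skewHexagon a₁ b₁ a₂ b₂ a₃ b₃ ∧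
      a₁ ≤ b₁ ∧ a₂ ≤ b₂ ∧ a₃ ≤ b₃ ∧
      volume (skewHexagon a₁ b₁ a₂ b₂ a₃ b₃) = ENNReal.ofReal (√3 / 2 *
        ((b₁ - a₁) * (b₂ - a₂) - (a₃ - a₁ - a₂) ^ 2 / 2 - (b₁ + b₂ - b₃) ^ 2 / 2)) ∧
      ENNReal.ofReal ((b₁ - a₁) + (b₂ - a₂) + (b₃ - a₃)) ≤ hexLength γ := by
  have hb : Bornology.IsBounded A := by
    apply isBounded_of_isBounded_frontier (by simp [hA])
    rw [← hγ.image_eq]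
    exact (isCompact_Icc.image_of_continuousOn hγ.continuousOn).isBounded
  have hne : A.Nonempty := nonempty_of_measure_ne_zero (by simp [hA] : volume A ≠ 0)
  obtain ⟨p₁, hp₁, mp₁⟩ := exists_frontier_isMaxOn hb hne (g := fun p => - skewX p)
    (by fun_prop) (d := ofSkew (-1) 0) (fun p c hc => by simp; exact hc)
  obtain ⟨q₁, hq₁, mq₁⟩ := exists_frontier_isMaxOn hb hne (g := skewX)
    (by fun_prop) (d := ofSkew 1 0) (fun p c hc => by simp; exact hc)
  obtain ⟨p₂, hp₂, mp₂⟩ := exists_frontier_isMaxOn hb hne (g := fun p => - skewY p)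
    (by fun_prop) (d := ofSkew 0 (-1)) (fun p c hc => by simp; exact hc)
  obtain ⟨q₂, hq₂, mq₂⟩ := exists_frontier_isMaxOn hb hne (g := skewY)
    (by fun_prop) (d := ofSkew 0 1) (fun p c hc => by simp; exact hc)
  obtain ⟨p₃, hp₃, mp₃⟩ := exists_frontier_isMaxOn hb hne (g := fun p => - (skewX p + skewY p))
    (by fun_prop) (d := ofSkew (-1) 0) (fun p c hc => by simp; linarith)
  obtain ⟨q₃, hq₃, mq₃⟩ := exists_frontier_isMaxOn hb hne (g := fun p => skewX p + skewY p)
    (by fun_prop) (d := ofSkew 1 0) (fun p c hc => by simp; linarith)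
  simp only [neg_le_neg_iff] at mp₁ mp₂ mp₃
  have hsub : closure A ⊆ skewHexagon (skewX p₁) (skewX q₁) (skewY p₂) (skewY q₂)
      (skewX p₃ + skewY p₃) (skewX q₃ + skewY q₃) := fun x hx =>
    ⟨⟨mp₁ x hx, mq₁ x hx⟩, ⟨mp₂ x hx, mq₂ x hx⟩, mp₃ x hx, mq₃ x hx⟩
  -- Every side of the hexagon contains a point of `closure A`, which obeys all the other bounds;
  -- this yields the inequalities required by `volume_skewHexagon`.
  obtain ⟨⟨_, _⟩, ⟨_, _⟩, _, _⟩ := hsub (frontier_subset_closure hp₁)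
  obtain ⟨⟨_, _⟩, ⟨_, _⟩, _, _⟩ := hsub (frontier_subset_closure hq₁)
  obtain ⟨⟨_, _⟩, ⟨_, _⟩, _, _⟩ := hsub (frontier_subset_closure hp₂)
  obtain ⟨⟨_, _⟩, ⟨_, _⟩, _, _⟩ := hsub (frontier_subset_closure hq₂)
  obtain ⟨⟨_, _⟩, ⟨_, _⟩, _, _⟩ := hsub (frontier_subset_closure hp₃)
  obtain ⟨⟨_, _⟩, ⟨_, _⟩, _, _⟩ := hsub (frontier_subset_closure hq₃)
  refine ⟨_, _, _, _, _, _, hsub, by linarith, by linarith, by linarith, ?_, ?_⟩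
  · apply volume_skewHexagon <;> linarith
  · rw [← hγ.image_eq] at hp₁ hq₁ hp₂ hq₂ hp₃ hq₃
    refine le_trans (ENNReal.ofReal_le_ofReal ?_)
      (ofReal_widths_le_hexLength hγ.closed hq₁ hp₁ hq₂ hp₂ hq₃ hp₃)
    exact add_le_add (add_le_add (le_abs_self _) (le_abs_self _)) (le_abs_self _)

theorem three_mul_sq_le_of_one_le_volume {B : Set (ℝ × ℝ)} {E : ℝ} (hB : 1 ≤ volume B)
    (h : volume B = ENNReal.ofReal (√3 / 2 * E)) : 3 * unitSide ^ 2 ≤ E := by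
  have h3 := sqrt_three_pos
  rw [h, ENNReal.one_le_ofReal, ← unitSide_sq] at hB
  exact le_of_mul_le_mul_left hB (by positivity)

/-- The isoperimetric inequality for the hexagonal norm. -/
theorem le_hexLength {A : Set (ℝ × ℝ)} {γ : ℝ → ℝ × ℝ} (hγ : IsBoundaryCurve A γ)
    (hA : volume A = 1) : ENNReal.ofReal (6 * unitSide) ≤ hexLength γ := by
  obtain ⟨a₁, b₁, a₂, b₂, a₃, b₃, hsub, h1, h2, h3, hvol, hlen⟩ :=
    exists_circumscribed_hexagon hγ hA
  have hE := three_mul_sq_le_of_one_le_volume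
    (hA ▸ measure_mono (subset_closure.trans hsub)) hvol
  refine le_trans (ENNReal.ofReal_le_ofReal ?_) hlen
  apply le_of_sq_le_sq _ (by linarith)
  -- Let `x = a₃ - a₁ - a₂`, `y = b₁ + b₂ - b₃` and `wᵢ = bᵢ - aᵢ`. As `x + y = w₁ + w₂ - w₃`, one
  -- has `(w₁ + w₂ + w₃)² - 12 * E = 3 * (x - y)² + 2 * ∑ (wᵢ - wⱼ)²`, the sum being over pairs `i <
  -- j`.
  nlinarith [sq_nonneg ((a₃ - a₁ - a₂) - (b₁ + b₂ - b₃)), sq_nonneg ((b₁ - a₁) - (b₂ - a₂)),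
    sq_nonneg ((b₁ - a₁) - (b₃ - a₃)), sq_nonneg ((b₂ - a₂) - (b₃ - a₃))]

/-- The equality case of the isoperimetric inequality, up to null sets. -/
theorem exists_closure_eq_hexBall {A : Set (ℝ × ℝ)} {γ : ℝ → ℝ × ℝ} (hγ : IsBoundaryCurve A γ)
    (hA : volume A = 1) (hle : hexLength γ ≤ ENNReal.ofReal (6 * unitSide)) :
    ∃ v, closure A = hexBall v unitSide := by
  obtain ⟨a₁, b₁, a₂, b₂, a₃, b₃, hsub, h1, h2, h3, hvol, hlen⟩ :=
    exists_circumscribed_hexagon hγ hA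
  have hr := unitSide_pos
  have hE := three_mul_sq_le_of_one_le_volume
    (hA ▸ measure_mono (subset_closure.trans hsub)) hvol
  have hw := (ENNReal.ofReal_le_ofReal_iff (by positivity)).1 (hlen.trans hle)
  have hw2 : ((b₁ - a₁) + (b₂ - a₂) + (b₃ - a₃)) ^ 2 ≤ (6 * unitSide) ^ 2 :=
    pow_le_pow_left₀ (by linarith) hw 2
  have s1 := sq_nonneg ((a₃ - a₁ - a₂) - (b₁ + b₂ - b₃))
  have s2 := sq_nonneg ((b₁ - a₁) - (b₂ - a₂))
  have s3 := sq_nonneg ((b₁ - a₁) - (b₃ - a₃))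
  have s4 := sq_nonneg ((b₂ - a₂) - (b₃ - a₃))
  -- The same identity now has a nonpositive left side, so each square is zero.
  have e1 : (a₃ - a₁ - a₂) - (b₁ + b₂ - b₃) = 0 := pow_eq_zero_iff two_ne_zero |>.1 (by nlinarith)
  have e2 : (b₁ - a₁) - (b₂ - a₂) = 0 := pow_eq_zero_iff two_ne_zero |>.1 (by nlinarith)
  have e3 : (b₁ - a₁) - (b₃ - a₃) = 0 := pow_eq_zero_iff two_ne_zero |>.1 (by nlinarith)
  have hw' : 6 * unitSide ≤ (b₁ - a₁) + (b₂ - a₂) + (b₃ - a₃) := by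
    apply le_of_sq_le_sq _ (by linarith)
    nlinarith
  set v := ofSkew ((a₁ + b₁) / 2) ((a₂ + b₂) / 2) with hv
  have hball : skewHexagon a₁ b₁ a₂ b₂ a₃ b₃ = hexBall v unitSide := by
    rw [hexBall_eq_skewHexagon, hv, skewX_ofSkew, skewY_ofSkew]
    congr 1 <;> linarith
  rw [hball] at hsub
  refine ⟨v, subset_antisymm hsub ?_⟩
  rw [← (isClosed_hexBall v _).closure_eq, ← (convex_hexBall v
    _).closure_interior_eq_closure_of_nonempty_interior (nonempty_interior_hexBall v hr)]
  apply closure_minimal _ isClosed_closure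
  rw [← sdiff_eq_empty]
  -- Both sets have area 1, so the open part of the hexagon outside `closure A` is null, hence
  -- empty.
  apply (isOpen_interior.sdiff isClosed_closure).eq_empty_of_measure_zero (μ := volume)
  refine measure_mono_null (sdiff_subset_sdiff_left interior_subset) ?_
  rw [measure_sdiff hsub isClosed_closure.measurableSet.nullMeasurableSet
    (measure_mono hsub |>.trans_lt (by simp [volume_hexBall_unitSide])).ne,
    volume_hexBall_unitSide, tsub_eq_zero_iff_le, ← hA]
  exact measure_mono subset_closure

/-! ### Characterization of the minimizers -/

theorem exists_between_of_hexLength_le {A : Set (ℝ × ℝ)} {γ : ℝ → ℝ × ℝ}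
    (hγ : IsBoundaryCurve A γ) (hA : volume A = 1)
    (hle : hexLength γ ≤ ENNReal.ofReal (6 * unitSide)) :
    ∃ v, interior (hexBall v unitSide) ⊆ A ∧ A ⊆ hexBall v unitSide := by
  obtain ⟨v, hv⟩ := exists_closure_eq_hexBall hγ hA hle
  have hr := unitSide_pos
  have hsub : A ⊆ hexBall v unitSide := hv ▸ subset_closure
  have hint : interior A ⊆ interior (hexBall v unitSide) := interior_mono hsub
  refine ⟨v, ?_, hsub⟩
  -- The vertices lie in `closure A` but not in the interior of the hexagon, which contains
  -- `interior A`; so they are frontier points.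
  have hvert : ∀ i, v + unitSide • hexVertex i ∈ γ '' Icc 0 1 := by
    intro i
    have hnorm : hexNorm (v + unitSide • hexVertex i - v) = unitSide := by
      rw [add_sub_cancel_left, hexNorm_smul, hexNorm_hexVertex, abs_of_pos hr, mul_one]
    rw [hγ.image_eq]
    refine ⟨hv ▸ mem_hexBall.2 hnorm.le, fun h => ?_⟩
    have h := hint h
    rw [interior_hexBall v hr, mem_ofPred_eq, hnorm] at h
    exact lt_irrefl _ h
  have hdisj : Disjoint (interior (hexBall v unitSide)) (frontier A) := by
    rw [disjoint_left]
    intro x hx hxA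
    rw [interior_hexBall v hr, mem_ofPred_eq] at hx
    rw [← hγ.image_eq] at hxA
    exact absurd hx (not_lt.2 (le_hexNorm_of_vertices_mem hγ.closed hr hle hvert hxA))
  rcases subset_interior_or_disjoint_closure
    (convex_hexBall v unitSide).interior.isPreconnected hdisj with h | h
  · exact h.trans interior_subset
  · obtain ⟨x, hx⟩ := nonempty_interior_hexBall v hr
    exact absurd (hv ▸ interior_subset hx) (disjoint_left.1 h hx)

theorem hasHexPerimeter_of_between {A : Set (ℝ × ℝ)} {v : ℝ × ℝ}
    (h1 : interior (hexBall v unitSide) ⊆ A) (h2 : A ⊆ hexBall v unitSide) :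
    HasHexPerimeter A (ENNReal.ofReal (6 * unitSide)) := by
  have hγ := isBoundaryCurve_hexCurve unitSide_pos
    (frontier_of_interior_hexBall_subset unitSide_pos h1 h2)
  exact ⟨_, hγ, le_antisymm (hexLength_hexCurve_le v unitSide_pos.le)
    (le_hexLength hγ (volume_of_interior_hexBall_subset h1 h2))⟩

theorem isIsoperimetricSolution_of_between {C : Set (Set (ℝ × ℝ))} {A : Set (ℝ × ℝ)} {v : ℝ × ℝ}
    (hC : A ∈ C) (h1 : interior (hexBall v unitSide) ⊆ A) (h2 : A ⊆ hexBall v unitSide) :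
    IsIsoperimetricSolution C A := by
  refine ⟨hC, volume_of_interior_hexBall_subset h1 h2, _, hasHexPerimeter_of_between h1 h2, ?_⟩
  rintro A' - hA' ℓ' ⟨γ, hγ, rfl⟩
  exact le_hexLength hγ hA'

/-- The open hexagon at the origin serves as competitor, so any class that contains it has the same
bound. -/
theorem IsIsoperimetricSolution.exists_between {C : Set (Set (ℝ × ℝ))} {A : Set (ℝ × ℝ)}
    (hA : IsIsoperimetricSolution C A) (hC : interior (hexBall 0 unitSide) ∈ C) :
    ∃ v, interior (hexBall v unitSide) ⊆ A ∧ A ⊆ hexBall v unitSide := by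
  obtain ⟨-, hvol, ℓ, ⟨γ, hγ, rfl⟩, hmin⟩ := hA
  exact exists_between_of_hexLength_le hγ hvol (hmin _ hC
    (volume_of_interior_hexBall_subset subset_rfl interior_subset) _
    (hasHexPerimeter_of_between subset_rfl interior_subset))

theorem interior_hexBall_mem_simplyConnectedOpenSets (v : ℝ × ℝ) {r : ℝ} (hr : 0 < r) :
    interior (hexBall v r) ∈ simplyConnectedOpenSets := by
  refine ⟨isOpen_interior, ?_⟩
  have := (convex_hexBall v r).interior.contractibleSpace (nonempty_interior_hexBall v hr)
  exact (inferInstance : SimplyConnectedSpace (interior (hexBall v r)))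

end HexIso

theorem lemma3p3 :
    {p : ℝ × ℝ | HexIso.hexNorm p ≤ 1} = HexIso.regularHexagon ∧
    (∀ A : Set (ℝ × ℝ),
      HexIso.IsIsoperimetricSolution HexIso.simplyConnectedOpenSets A ↔
        ∃ v : ℝ × ℝ, A = interior (HexIso.unitAreaHexagonAt v)) ∧
    (∀ A : Set (ℝ × ℝ),
      HexIso.IsIsoperimetricSolution Set.univ A ↔
        ∃ v : ℝ × ℝ, interior (HexIso.unitAreaHexagonAt v) ⊆ A ∧
          A ⊆ HexIso.unitAreaHexagonAt v) := by
  simp only [HexIso.unitAreaHexagonAt_eq]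
  refine ⟨HexIso.hexBall_eq_regularHexagon, fun A => ⟨fun hA => ?_, ?_⟩,
    fun A => ⟨fun hA => ?_, ?_⟩⟩
  · obtain ⟨v, h1, h2⟩ := hA.exists_between
      (HexIso.interior_hexBall_mem_simplyConnectedOpenSets 0 HexIso.unitSide_pos)
    exact ⟨v, subset_antisymm (interior_maximal h2 hA.1.1) h1⟩
  · rintro ⟨v, rfl⟩
    exact HexIso.isIsoperimetricSolution_of_between
      (HexIso.interior_hexBall_mem_simplyConnectedOpenSets v HexIso.unitSide_pos)
      subset_rfl interior_subset
  · exact hA.exists_between (mem_univ _)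
  · rintro ⟨v, h1, h2⟩
    exact HexIso.isIsoperimetricSolution_of_between (mem_univ _) h1 h2
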